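/- Let $D\in\mathbb N$ and $\sigma>0$. On $\mathbb C^D$ with Lebesgue measure $V_D$ and Euclidean norm $\|\cdot\|_2$ consider the Laplacian measure $$d\mu_{L}(z)=(2\pi\sigma^2)^{-D}\,e^{-\|z\|_2/\sigma}\,dV_D(z),$$ and let $H_L$ be the reproducing kernel Hilbert space of all holomorphic functions $f:\mathbb C^D\to\mathbb C$ with $\int_{\mathbb C^D}|f|^2\,d\mu_L<\infty$, with inner product $\langle f,g\rangle=\int_{\mathbb C^D} f\,\overline{g}\,d\mu_L$. Let $K_z\in H_L$ denote its reproducing kernel at $z\in\mathbb C^D$, that is, $f(z)=\langle f,K_z\rangle$ for all $f\in H_L$. Let $A\in\mathbb C^{D\times D}$ be an invertible matrix with $0<\|A\|_{\mathrm{Frob}}<1$, let $b\in\mathbb C^D$, and put $\varphi(z)=Az+b$. Suppose that the Koopman operator $\mathcal K_\varphi f=f\circ\varphi$ is a bounded operator on $H_L$, and set $$\Pi_z(\varphi;\sigma)=\|K_z\|^{-2}\,\|\mathcal K_\varphi^*K_z\|^2\qquad(z\in\mathbb C^D).$$ Then $\mathcal K_\varphi$ is a compact operator on $H_L$ if and only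 if $$\lim_{\|z\|_2\to\infty}\Pi_z(\varphi;\sigma)=0 .$$ -/

import Mathlib

open MeasureTheory Filter Topology
open scoped ComplexConjugate

noncomputable section

/-- `ℂ^D` with its Euclidean norm `‖·‖₂`. -/
abbrev CSpace (D : ℕ) : Type := EuclideanSpace ℂ (Fin D)

/-- The density `(2πσ²)^{-D} exp(-‖z‖₂/σ)`. -/
def laplaceDensity (D : ℕ) (σ : ℝ) (z : CSpace D) : ℝ :=
  ((2 * Real.pi * σ ^ 2) ^ D)⁻¹ * Real.exp (-‖z‖ / σ)

/-- The Laplacian measure `(2πσ²)^{-D} exp(-‖z‖₂/σ) dV_D(z)` on `ℂ^D`, where `V_D` is Lebesgue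
measure on `ℂ^D ≅ ℝ^{2D}`. -/
def laplaceMeasure (D : ℕ) (σ : ℝ) : Measure (CSpace D) :=
  (volume : Measure (CSpace D)).withDensity fun z => ENNReal.ofReal (laplaceDensity D σ z)

/-- The entire functions on `ℂ^D` that are square integrable for the Laplacian measure. -/
def laplaceSubmodule (D : ℕ) (σ : ℝ) : Submodule ℂ (CSpace D → ℂ) where
  carrier := {f | Differentiable ℂ f ∧ MemLp f 2 (laplaceMeasure D σ)}
  add_mem' hf hg := ⟨hf.1.add hg.1, hf.2.add hg.2⟩
  zero_mem' := ⟨differentiable_const (0 : ℂ), MemLp.zero⟩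
  smul_mem' c _ hf := ⟨hf.1.const_smul c, hf.2.const_smul c⟩

/-- The space `H_L` of entire functions, square integrable for the Laplacian measure.  (It is a
type of its own so that it does not inherit the topology of pointwise convergence.) -/
def LaplaceSpace (D : ℕ) (σ : ℝ) : Type := laplaceSubmodule D σ

namespace LaplaceSpace

variable {D : ℕ} {σ : ℝ}

instance : AddCommGroup (LaplaceSpace D σ) :=
  inferInstanceAs (AddCommGroup (laplaceSubmodule D σ))

instance : Module ℂ (LaplaceSpace D σ) :=
  inferInstanceAs (Module ℂ (laplaceSubmodule D σ))

/-- The function underlying an element of `H_L`. -/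
def toFun (f : LaplaceSpace D σ) : CSpace D → ℂ := Subtype.val f

theorem toFun_injective : Function.Injective (toFun : LaplaceSpace D σ → CSpace D → ℂ) :=
  Subtype.val_injective

theorem differentiable_toFun (f : LaplaceSpace D σ) : Differentiable ℂ f.toFun :=
  (Subtype.property f).1

theorem memLp_toFun (f : LaplaceSpace D σ) : MemLp f.toFun 2 (laplaceMeasure D σ) :=
  (Subtype.property f).2

/-- An entire square integrable function as an element of `H_L`. -/
def mk (f : CSpace D → ℂ) (h1 : Differentiable ℂ f) (h2 : MemLp f 2 (laplaceMeasure D σ)) :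
    LaplaceSpace D σ := (⟨f, h1, h2⟩ : laplaceSubmodule D σ)

theorem toFun_add (f g : LaplaceSpace D σ) : (f + g).toFun = f.toFun + g.toFun := rfl

theorem toFun_sub (f g : LaplaceSpace D σ) : (f - g).toFun = f.toFun - g.toFun := rfl

theorem toFun_smul (c : ℂ) (f : LaplaceSpace D σ) : (c • f).toFun = c • f.toFun := rfl

theorem laplaceDensity_pos (hσ : 0 < σ) (z : CSpace D) : 0 < laplaceDensity D σ z := by
  unfold laplaceDensity
  have := Real.pi_pos
  positivity

theorem continuous_laplaceDensity : Continuous (laplaceDensity D σ) := by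
  unfold laplaceDensity
  fun_prop

theorem volume_ac (hσ : 0 < σ) : (volume : Measure (CSpace D)) ≪ laplaceMeasure D σ := by
  refine withDensity_absolutelyContinuous' ?_ ?_
  · exact (continuous_laplaceDensity.measurable.ennreal_ofReal).aemeasurable
  · refine Eventually.of_forall fun z => ?_
    simpa using laplaceDensity_pos hσ z

theorem integrable_mul (f g : LaplaceSpace D σ) :
    Integrable (fun z => g.toFun z * conj (f.toFun z)) (laplaceMeasure D σ) := by
  have := MemLp.integrable_mul (p := 2) (q := 2) g.memLp_toFun f.memLp_toFun.star
  exact this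

theorem integrable_sq (f : LaplaceSpace D σ) :
    Integrable (fun z => ‖f.toFun z‖ ^ 2) (laplaceMeasure D σ) :=
  f.memLp_toFun.integrable_norm_pow (p := 2) (by norm_num)

theorem inner_self (f : LaplaceSpace D σ) :
    ∫ z, f.toFun z * conj (f.toFun z) ∂(laplaceMeasure D σ)
      = ((∫ z, ‖f.toFun z‖ ^ 2 ∂(laplaceMeasure D σ) : ℝ) : ℂ) := by
  rw [← integral_complex_ofReal]
  refine integral_congr_ae (Eventually.of_forall fun z => ?_)
  simp [Complex.mul_conj, Complex.normSq_eq_norm_sq]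

theorem eq_of_ae_eq (hσ : 0 < σ) {f g : CSpace D → ℂ} (hf : Continuous f) (hg : Continuous g)
    (h : f =ᵐ[laplaceMeasure D σ] g) : f = g :=
  Measure.eq_of_ae_eq ((volume_ac hσ).ae_eq h) hf hg

/-- The inner product `∫ f ḡ dμ_L`.  In Mathlib's convention `inner ℂ f g` is linear in the second
argument, so `inner ℂ f g` is `⟨g, f⟩`. -/
instance innerCore [Fact (0 < σ)] : InnerProductSpace.Core ℂ (LaplaceSpace D σ) where
  inner f g := ∫ z, g.toFun z * conj (f.toFun z) ∂(laplaceMeasure D σ)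
  conj_inner_symm f g := by
    rw [← integral_conj]
    simp [mul_comm]
  re_inner_nonneg f := by
    rw [inner_self]
    simpa using integral_nonneg (fun z => by positivity)
  add_left f g h := by
    rw [← integral_add (integrable_mul f h) (integrable_mul g h)]
    simp [toFun_add, mul_add]
  smul_left f g c := by
    rw [← integral_const_mul]
    simp [toFun_smul, mul_left_comm]
  definite f h := by
    rw [inner_self, Complex.ofReal_eq_zero,
      integral_eq_zero_iff_of_nonneg (fun z => by positivity) (integrable_sq f)] at h
    have h0 : f.toFun =ᵐ[laplaceMeasure D σ] fun _ => 0 := by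
      filter_upwards [h] with z hz
      simpa using hz
    exact toFun_injective
      (eq_of_ae_eq Fact.out f.differentiable_toFun.continuous continuous_const h0)

instance [Fact (0 < σ)] : NormedAddCommGroup (LaplaceSpace D σ) :=
  innerCore.toNormedAddCommGroup

instance [Fact (0 < σ)] : InnerProductSpace ℂ (LaplaceSpace D σ) :=
  InnerProductSpace.ofCore innerCore.toCore

theorem inner_eq [Fact (0 < σ)] (f g : LaplaceSpace D σ) :
    inner ℂ f g = ∫ z, g.toFun z * conj (f.toFun z) ∂(laplaceMeasure D σ) := rfl

theorem norm_sq_eq [Fact (0 < σ)] (f : LaplaceSpace D σ) :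
    ‖f‖ ^ 2 = ∫ z, ‖f.toFun z‖ ^ 2 ∂(laplaceMeasure D σ) := by
  have h := inner_self_eq_norm_sq_to_K (𝕜 := ℂ) f
  rw [inner_eq, inner_self] at h
  refine Complex.ofReal_injective ?_
  rw [h]
  simp

/-! Point evaluations are bounded, locally uniformly in the point. -/

/-- Mean value property over a ball. -/
theorem mean_value {f : CSpace D → ℂ} (hf : Differentiable ℂ f) (z : CSpace D) :
    ∫ w in Metric.closedBall (0 : CSpace D) 1, f (z + w)
      = (volume (Metric.closedBall (0 : CSpace D) 1)).toReal • f z := by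
  set B := Metric.closedBall (0 : CSpace D) 1 with hB
  have hrot : ∀ θ : ℝ, ∫ w in B, f (z + circleMap 0 1 θ • w) = ∫ w in B, f (z + w) := by
    intro θ
    have hc : ‖circleMap 0 1 θ‖ = 1 := by simp
    have hc0 : circleMap 0 1 θ ≠ 0 := by
      intro h; simp [h] at hc
    let e : CSpace D ≃ₗᵢ[ℝ] CSpace D :=
      { (LinearEquiv.smulOfNeZero ℂ (CSpace D) (circleMap 0 1 θ) hc0).restrictScalars ℝ with
        norm_map' := fun w => by
          change ‖circleMap 0 1 θ • w‖ = ‖w‖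
          rw [norm_smul, hc, one_mul] }
    have he : ∀ w, e w = circleMap 0 1 θ • w := fun w => rfl
    have h1 := e.measurePreserving.setIntegral_preimage_emb
      e.toHomeomorph.measurableEmbedding (fun w => f (z + w)) B
    have h2 : (e : CSpace D → CSpace D) ⁻¹' B = B := by
      ext w
      simp [hB]
    rw [h2] at h1
    simpa only [he] using h1
  have hcirc : ∀ w : CSpace D,
      ∫ θ in (0 : ℝ)..(2 * Real.pi), f (z + circleMap 0 1 θ • w) = (2 * Real.pi) • f z := by
    intro w
    have hd : Differentiable ℂ fun t : ℂ => f (z + t • w) :=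
      hf.comp ((differentiable_const z).add (differentiable_id.smul_const w))
    have h := (hd.diffContOnCl (s := Metric.ball 0 |(1 : ℝ)|)).circleAverage
    rw [Real.circleAverage] at h
    have hpi : (2 * Real.pi) ≠ 0 := by positivity
    rw [inv_smul_eq_iff₀ hpi] at h
    simpa using h
  have hcont : Continuous fun p : ℝ × CSpace D => f (z + circleMap 0 1 p.1 • p.2) := by
    refine hf.continuous.comp (continuous_const.add ?_)
    exact ((continuous_circleMap 0 1).comp continuous_fst).smul continuous_snd
  have hswap := intervalIntegral_integral_swap (μ := volume.restrict B) (a := 0)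
    (b := 2 * Real.pi) (f := fun θ w => f (z + circleMap 0 1 θ • w)) (by
      rw [Measure.prod_restrict]
      refine IntegrableOn.mono_set (t := Set.uIcc 0 (2 * Real.pi) ×ˢ B) ?_
        (Set.prod_mono Set.uIoc_subset_uIcc subset_rfl)
      exact hcont.continuousOn.integrableOn_compact
        (isCompact_uIcc.prod (isCompact_closedBall _ _)))
  simp only [hrot, hcirc] at hswap
  simp only [intervalIntegral.integral_const, sub_zero, integral_const] at hswap
  have hpi : (2 * Real.pi) ≠ 0 := by positivity
  rw [smul_comm] at hswap
  simpa [Measure.real] using smul_right_injective ℂ hpi hswap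

/-- On every ball, evaluation of elements of `H_L` is uniformly bounded. -/
theorem exists_eval_bound [Fact (0 < σ)] (R : ℝ) :
    ∃ C : ℝ, 0 ≤ C ∧ ∀ f : LaplaceSpace D σ, ∀ z : CSpace D, ‖z‖ ≤ R →
      ‖f.toFun z‖ ≤ C * ‖f‖ := by
  have hσ : 0 < σ := Fact.out
  set v : ℝ := (volume (Metric.closedBall (0 : CSpace D) 1)).toReal with hv
  have hvpos : 0 < v := ENNReal.toReal_pos
    (Metric.measure_closedBall_pos volume _ one_pos).ne' measure_closedBall_lt_top.ne
  set m : ℝ := ((2 * Real.pi * σ ^ 2) ^ D)⁻¹ * Real.exp (-(R + 1) / σ) with hm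
  have hmpos : 0 < m := by
    have := Real.pi_pos
    positivity
  refine ⟨Real.sqrt ((v * m)⁻¹), Real.sqrt_nonneg _, fun f z hz => ?_⟩
  have hfc := f.differentiable_toFun.continuous
  have hint : Integrable (fun w => laplaceDensity D σ w * ‖f.toFun w‖ ^ 2) := by
    have h := integrable_sq f
    rw [laplaceMeasure, integrable_withDensity_iff_integrable_smul'
      continuous_laplaceDensity.measurable.ennreal_ofReal (by simp)] at h
    refine h.congr (Eventually.of_forall fun w => ?_)
    simp [ENNReal.toReal_ofReal (laplaceDensity_pos hσ w).le]
  have hnorm : ‖f‖ ^ 2 = ∫ w, laplaceDensity D σ w * ‖f.toFun w‖ ^ 2 := by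
    rw [norm_sq_eq, laplaceMeasure, integral_withDensity_eq_integral_toReal_smul
      continuous_laplaceDensity.measurable.ennreal_ofReal (by simp)]
    refine integral_congr_ae (Eventually.of_forall fun w => ?_)
    simp [ENNReal.toReal_ofReal (laplaceDensity_pos hσ w).le]
  have hmv := mean_value (f := fun w => f.toFun w ^ 2) (f.differentiable_toFun.pow 2) z
  have h1 : v * ‖f.toFun z‖ ^ 2 ≤ ∫ w in Metric.closedBall (0 : CSpace D) 1,
      ‖f.toFun (z + w)‖ ^ 2 := by
    have := norm_integral_le_integral_norm (μ := volume.restrict (Metric.closedBall 0 1))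
      (fun w => f.toFun (z + w) ^ 2)
    rw [hmv, norm_smul, Real.norm_of_nonneg hvpos.le] at this
    simpa only [norm_pow] using this
  have h2 : m * ∫ w in Metric.closedBall (0 : CSpace D) 1, ‖f.toFun (z + w)‖ ^ 2 ≤ ‖f‖ ^ 2 := by
    rw [← integral_const_mul, hnorm,
      ← integral_add_left_eq_self (μ := (volume : Measure (CSpace D))) _ z]
    have hint' := hint.comp_add_left z
    refine le_trans (setIntegral_mono_on ?_ hint'.integrableOn
      Metric.isClosed_closedBall.measurableSet ?_)
      (setIntegral_le_integral hint' (Eventually.of_forall fun w => ?_))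
    · refine ContinuousOn.integrableOn_compact (isCompact_closedBall _ _)
        (Continuous.continuousOn ?_)
      exact continuous_const.mul ((hfc.comp (continuous_const.add continuous_id)).norm.pow 2)
    · intro w hw
      refine mul_le_mul_of_nonneg_right ?_ (by positivity)
      rw [hm, laplaceDensity]
      have hw' : ‖w‖ ≤ 1 := by simpa using hw
      have : ‖z + w‖ ≤ R + 1 := (norm_add_le _ _).trans (add_le_add hz hw')
      have := Real.pi_pos
      gcongr
    · exact mul_nonneg (laplaceDensity_pos hσ _).le (by positivity)
  have h3 : ‖f.toFun z‖ ^ 2 ≤ (v * m)⁻¹ * ‖f‖ ^ 2 := by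
    rw [inv_mul_eq_div, le_div_iff₀ (by positivity)]
    nlinarith [mul_le_mul_of_nonneg_left h1 hmpos.le]
  rw [← Real.sqrt_sq (norm_nonneg f), ← Real.sqrt_mul (by positivity)]
  exact Real.le_sqrt_of_sq_le h3

/-- `H_L` as a linear subspace of `L²(μ_L)`. -/
def toLpₗᵢ [Fact (0 < σ)] : LaplaceSpace D σ →ₗᵢ[ℂ] Lp ℂ 2 (laplaceMeasure D σ) where
  toFun f := f.memLp_toFun.toLp f.toFun
  map_add' f g := MemLp.toLp_add f.memLp_toFun g.memLp_toFun
  map_smul' c f := MemLp.toLp_const_smul c f.memLp_toFun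
  norm_map' f := by
    have h : ‖f.memLp_toFun.toLp f.toFun‖ ^ 2 = ‖f‖ ^ 2 := by
      have h1 := inner_self_eq_norm_sq_to_K (𝕜 := ℂ) (f.memLp_toFun.toLp f.toFun)
      have h2 := inner_self_eq_norm_sq_to_K (𝕜 := ℂ) f
      rw [inner_eq] at h2
      rw [L2.inner_def] at h1
      have h3 : ∫ a, inner ℂ ((f.memLp_toFun.toLp f.toFun) a) ((f.memLp_toFun.toLp f.toFun) a)
          ∂(laplaceMeasure D σ) = ∫ z, f.toFun z * conj (f.toFun z) ∂(laplaceMeasure D σ) := by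
        refine integral_congr_ae ?_
        filter_upwards [f.memLp_toFun.coeFn_toLp] with a ha
        rw [ha]
        simp [Complex.mul_conj, Complex.normSq_eq_norm_sq]
      rw [h3, h2] at h1
      refine Complex.ofReal_injective ?_
      simpa using h1.symm
    exact (sq_eq_sq₀ (norm_nonneg _) (norm_nonneg _)).1 h

/-- A locally uniform limit of entire functions on `ℂ^D` is entire. -/
theorem differentiable_of_tendsto {F : ℕ → CSpace D → ℂ} {f : CSpace D → ℂ}
    (hF : ∀ n, Differentiable ℂ (F n))
    (hlim : ∀ R : ℝ, TendstoUniformlyOn F f atTop (Metric.ball 0 R)) : Differentiable ℂ f := by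
  have hlim' : ∀ z, Tendsto (fun n => F n z) atTop (𝓝 (f z)) := fun z =>
    (hlim (‖z‖ + 1)).tendsto_at (by simp)
  have hbound : ∀ (h : CSpace D → ℂ) (z : CSpace D) (M : ℝ), 0 < M → Differentiable ℂ h →
      (∀ w ∈ Metric.ball z 1, ‖h w‖ < M) → ‖fderiv ℂ h z‖ ≤ 2 * M := by
    intro h z M hM hh hb
    have := Complex.norm_fderiv_le_div_of_mapsTo_ball (c := z) (R₁ := 1) (R₂ := 2 * M)
      hh.differentiableOn (fun w hw => by
        rw [Metric.mem_closedBall, dist_eq_norm]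
        have h1 := hb w hw
        have h2 := hb z (Metric.mem_ball_self one_pos)
        have := norm_sub_le (h w) (h z)
        linarith) one_pos
    simpa using this
  have hC : ∀ R : ℝ, UniformCauchySeqOn (fun n => fderiv ℂ (F n)) atTop (Metric.ball 0 R) := by
    intro R
    rw [Metric.uniformCauchySeqOn_iff]
    intro ε hε
    obtain ⟨N, hN⟩ := Metric.uniformCauchySeqOn_iff.1 (hlim (R + 1)).uniformCauchySeqOn
      (ε / 4) (by positivity)
    refine ⟨N, fun k hk n hn z hz => ?_⟩
    have hz' : ‖z‖ < R := by simpa using hz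
    have := hbound (F k - F n) z (ε / 4) (by positivity) ((hF k).sub (hF n)) (fun w hw => by
      have hw' : ‖w - z‖ < 1 := by simpa [dist_eq_norm] using hw
      have := hN k hk n hn w (by
        have := norm_add_le (w - z) z
        rw [sub_add_cancel] at this
        simp only [Metric.mem_ball, dist_zero_right]
        linarith)
      simpa [dist_eq_norm] using this)
    rw [fderiv_sub (hF k z) (hF n z)] at this
    rw [dist_eq_norm]
    linarith
  have hpt : ∀ z, ∃ L, Tendsto (fun n => fderiv ℂ (F n) z) atTop (𝓝 L) := fun z =>
    cauchySeq_tendsto_of_complete ((hC (‖z‖ + 1)).cauchySeq (x := z) (by simp))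
  choose L hL using hpt
  intro z
  exact (hasFDerivAt_of_tendstoUniformlyOn (s := Metric.ball 0 (‖z‖ + 1)) Metric.isOpen_ball
    ((hC (‖z‖ + 1)).tendstoUniformlyOn_of_tendsto fun w _ => hL w)
    (fun n w _ => (hF n w).hasFDerivAt) (fun w _ => hlim' w) (x := z) (by simp)).differentiableAt

instance [Fact (0 < σ)] : CompleteSpace (LaplaceSpace D σ) := by
  have hσ : 0 < σ := Fact.out
  refine Metric.complete_of_cauchySeq_tendsto fun F hF => ?_
  have hU : ∀ R : ℝ, UniformCauchySeqOn (fun n => (F n).toFun) atTop (Metric.ball 0 R) := by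
    intro R
    obtain ⟨C, hC0, hC⟩ := exists_eval_bound (D := D) (σ := σ) R
    rw [Metric.uniformCauchySeqOn_iff]
    intro ε hε
    obtain ⟨N, hN⟩ := Metric.cauchySeq_iff.1 hF (ε / (C + 1)) (by positivity)
    refine ⟨N, fun k hk n hn z hz => ?_⟩
    have h1 := hC (F k - F n) z (by simpa using (Metric.mem_ball.1 hz).le)
    have h2 := hN k hk n hn
    rw [dist_eq_norm, lt_div_iff₀ (by positivity)] at h2
    rw [dist_eq_norm]
    rw [toFun_sub, Pi.sub_apply] at h1
    nlinarith [norm_nonneg (F k - F n)]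
  have hpt : ∀ z, ∃ a, Tendsto (fun n => (F n).toFun z) atTop (𝓝 a) := fun z =>
    cauchySeq_tendsto_of_complete ((hU (‖z‖ + 1)).cauchySeq (x := z) (by simp))
  choose f hf using hpt
  have hfd : Differentiable ℂ f := differentiable_of_tendsto
    (fun n => (F n).differentiable_toFun)
    (fun R => (hU R).tendstoUniformlyOn_of_tendsto fun z _ => hf z)
  obtain ⟨g, hg⟩ := cauchySeq_tendsto_of_complete
    (toLpₗᵢ (D := D) (σ := σ).isometry.uniformContinuous.comp_cauchySeq hF)
  obtain ⟨ns, hns, hae⟩ := (tendstoInMeasure_of_tendsto_Lp hg).exists_seq_tendsto_ae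
  have hall : ∀ᵐ z ∂(laplaceMeasure D σ), ∀ n, (toLpₗᵢ (F n)) z = (F n).toFun z :=
    ae_all_iff.2 fun n => (F n).memLp_toFun.coeFn_toLp
  have hfg : f =ᵐ[laplaceMeasure D σ] g := by
    filter_upwards [hae, hall] with z h1 h2
    refine tendsto_nhds_unique ((hf z).comp hns.tendsto_atTop) (h1.congr fun n => ?_)
    exact h2 (ns n)
  have hfm : MemLp f 2 (laplaceMeasure D σ) := (memLp_congr_ae hfg).2 (Lp.memLp g)
  refine ⟨mk f hfd hfm, ?_⟩
  rw [(toLpₗᵢ (D := D) (σ := σ)).isometry.isEmbedding.tendsto_nhds_iff]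
  have hfin : toLpₗᵢ (mk f hfd hfm) = g := Lp.ext (hfm.coeFn_toLp.trans hfg)
  rw [hfin]
  exact hg

/-- `H_L` is a reproducing kernel Hilbert space of functions on `ℂ^D`. -/
instance [Fact (0 < σ)] : RKHS ℂ (LaplaceSpace D σ) (CSpace D) ℂ where
  coeCLM :=
    { toFun := toFun
      map_add' := toFun_add
      map_smul' := toFun_smul
      cont := by
        refine continuous_pi fun z => ?_
        obtain ⟨C, _, hC⟩ := exists_eval_bound (D := D) (σ := σ) ‖z‖
        let e : LaplaceSpace D σ →ₗ[ℂ] ℂ :=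
          { toFun := fun f => f.toFun z
            map_add' := fun _ _ => rfl
            map_smul' := fun _ _ => rfl }
        exact (e.mkContinuous C (fun f => hC f z le_rfl)).continuous }
  coeCLM_injective := toFun_injective

variable [Fact (0 < σ)]

/-- The reproducing kernel `K_z ∈ H_L` at `z`, i.e. `⟨f, K_z⟩ = f(z)` for all `f ∈ H_L`. -/
def kernelAt (D : ℕ) (σ : ℝ) [Fact (0 < σ)] (z : CSpace D) : LaplaceSpace D σ :=
  RKHS.kerFun (LaplaceSpace D σ) z 1

theorem inner_kernelAt (z : CSpace D) (f : LaplaceSpace D σ) :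
    inner ℂ (kernelAt D σ z) f = f z := by
  simp [kernelAt]

/-- `T` is the Koopman operator `K_φ f = f ∘ φ`, as a bounded operator defined on all of `H_L`. -/
def IsKoopman (φ : CSpace D → CSpace D) (T : LaplaceSpace D σ →L[ℂ] LaplaceSpace D σ) : Prop :=
  ∀ (f : LaplaceSpace D σ) (z : CSpace D), T f z = f (φ z)

/-- `Π_z = ‖K_z‖⁻² ‖T* K_z‖²`. -/
def berezin (T : LaplaceSpace D σ →L[ℂ] LaplaceSpace D σ) (z : CSpace D) : ℝ :=
  (‖kernelAt D σ z‖ ^ 2)⁻¹ * ‖ContinuousLinearMap.adjoint T (kernelAt D σ z)‖ ^ 2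

end LaplaceSpace

/-- The Frobenius norm of a complex matrix. -/
def frobeniusNorm {D : ℕ} (A : Matrix (Fin D) (Fin D) ℂ) : ℝ :=
  Real.sqrt (∑ i, ∑ j, ‖A i j‖ ^ 2)

/-- The affine map `z ↦ A z + b` on `ℂ^D`. -/
def affineSymbol {D : ℕ} (A : Matrix (Fin D) (Fin D) ℂ) (b : CSpace D) (z : CSpace D) :
    CSpace D :=
  Matrix.toEuclideanLin A z + b

end

/-!
Write `a = ‖A‖_Frob` and `φ z = A z + b`.  Since `a < 1`, both sides of the equivalence hold for
every such `φ`; this comes from the growth of the reproducing kernel, which is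
`‖K_z‖ ≈ exp (‖z‖ / (2σ))` up to a loss in the exponent.

* Upper bound (`LaplaceSpace.exists_norm_apply_le`): `|f z| ≤ C exp (‖z‖ / (2σ)) ‖f‖` for all
  `f ∈ H_L`, because translation by `z` multiplies the weight by at most `exp (‖z‖ / σ)` and
  evaluation at `0` is bounded.  Equivalently, `‖K_z‖ ≤ C exp (‖z‖ / (2σ))`.
* Lower bound (`LaplaceSpace.exists_le_norm_kernelAt`): `m exp (c ‖z‖) ≤ ‖K_z‖` for every
  `c < 1 / (2σ)`, tested on the exponentials `w ↦ exp (c ⟨w, z / ‖z‖⟩)`.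

As `K_φ* K_z = K_{φ z}` and `‖φ z‖ ≤ a ‖z‖ + ‖b‖`, the quotient `‖K_{φ z}‖ / ‖K_z‖` decays
exponentially: choose `c` strictly between `a / (2σ)` and `1 / (2σ)`.  The same estimate shows that
the functions `f ∘ φ` with `‖f‖ ≤ 1` are dominated by a constant multiple of
`exp (a ‖z‖ / (2σ))`, which belongs to `L²(μ_L)`.  A sequence in the unit ball has a pointwise
convergent subsequence (Banach-Alaoglu), and dominated convergence makes its image converge in
norm, so `K_φ` is compact (`LaplaceSpace.IsKoopman.isCompactOperator`).
-/

/-! ### Exponentials of the norm and the Frobenius bound -/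

/-- The integrand is at most a constant times `(1 + ‖x‖)⁻ⁿ` with `n = dim E + 1`. -/
theorem integrable_exp_neg_mul_norm {E : Type*} [NormedAddCommGroup E] [NormedSpace ℝ E]
    [FiniteDimensional ℝ E] [MeasurableSpace E] [BorelSpace E] (μ : Measure E)
    [μ.IsAddHaarMeasure] {c : ℝ} (hc : 0 < c) :
    Integrable (fun x : E => Real.exp (-(c * ‖x‖))) μ := by
  set n := Module.finrank ℝ E + 1 with hn
  have hint : Integrable (fun x : E => (1 + ‖x‖) ^ (-(n : ℝ))) μ :=
    integrable_one_add_norm (by rw [hn]; push_cast; linarith)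
  refine (hint.const_mul (Real.exp c * n.factorial / c ^ n)).mono'
    (by fun_prop) (Eventually.of_forall fun x => ?_)
  have hx : 0 < 1 + ‖x‖ := by positivity
  have h := Real.pow_div_factorial_le_exp (c * (1 + ‖x‖)) (by positivity) n
  rw [Real.norm_of_nonneg (Real.exp_nonneg _), Real.rpow_neg hx.le, Real.rpow_natCast,
    ← div_eq_mul_inv, div_div, le_div_iff₀ (by positivity), ← mul_pow]
  rw [div_le_iff₀ (by positivity)] at h
  calc Real.exp (-(c * ‖x‖)) * (c * (1 + ‖x‖)) ^ n
      ≤ Real.exp (-(c * ‖x‖)) * (Real.exp (c * (1 + ‖x‖)) * n.factorial) := by gcongr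
    _ = Real.exp c * n.factorial := by
      rw [← mul_assoc, ← Real.exp_add]; ring_nf

theorem norm_toEuclideanLin_le {D : ℕ} (A : Matrix (Fin D) (Fin D) ℂ) (z : CSpace D) :
    ‖Matrix.toEuclideanLin A z‖ ≤ frobeniusNorm A * ‖z‖ := by
  rw [frobeniusNorm, EuclideanSpace.norm_eq, EuclideanSpace.norm_eq z,
    ← Real.sqrt_mul (by positivity), Finset.sum_mul]
  refine Real.sqrt_le_sqrt (Finset.sum_le_sum fun i _ => ?_)
  have h : ‖Matrix.toEuclideanLin A z i‖ ≤ ∑ j, ‖A i j‖ * ‖z j‖ := by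
    simp only [Matrix.toLpLin_apply, Matrix.mulVec, dotProduct]
    simpa only [norm_mul] using norm_sum_le Finset.univ fun j => A i j * z j
  exact (pow_le_pow_left₀ (norm_nonneg _) h 2).trans (Finset.sum_mul_sq_le_sq_mul_sq _ _ _)

namespace LaplaceSpace

variable {D : ℕ} {σ : ℝ}

/-! ### Integration against the Laplacian measure -/

theorem integrable_laplaceMeasure_iff (hσ : 0 < σ) {g : CSpace D → ℝ} :
    Integrable g (laplaceMeasure D σ) ↔ Integrable fun z => laplaceDensity D σ z * g z := by
  rw [laplaceMeasure, integrable_withDensity_iff_integrable_smul'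
    continuous_laplaceDensity.measurable.ennreal_ofReal (by simp)]
  simp [ENNReal.toReal_ofReal (laplaceDensity_pos hσ _).le]

theorem integral_laplaceMeasure (hσ : 0 < σ) (g : CSpace D → ℝ) :
    ∫ z, g z ∂(laplaceMeasure D σ) = ∫ z, laplaceDensity D σ z * g z := by
  rw [laplaceMeasure, integral_withDensity_eq_integral_toReal_smul
    continuous_laplaceDensity.measurable.ennreal_ofReal (by simp)]
  simp [ENNReal.toReal_ofReal (laplaceDensity_pos hσ _).le]

theorem integrable_exp_mul_norm (hσ : 0 < σ) {c : ℝ} (hc : c < 1 / σ) :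
    Integrable (fun z : CSpace D => Real.exp (c * ‖z‖)) (laplaceMeasure D σ) := by
  rw [integrable_laplaceMeasure_iff hσ]
  refine ((integrable_exp_neg_mul_norm (volume : Measure (CSpace D)) (sub_pos.2 hc)).const_mul
    (((2 * Real.pi * σ ^ 2) ^ D)⁻¹)).congr (Eventually.of_forall fun z => ?_)
  simp only [laplaceDensity]
  rw [mul_assoc _ (Real.exp _) (Real.exp _), ← Real.exp_add]
  ring_nf

/-- The weight is at most multiplied by `exp (‖z‖ / σ)` under translation by `z`. -/
theorem laplaceDensity_le_add (hσ : 0 < σ) (z w : CSpace D) :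
    laplaceDensity D σ w ≤ Real.exp (‖z‖ / σ) * laplaceDensity D σ (z + w) := by
  have hπ := Real.pi_pos
  rw [laplaceDensity, laplaceDensity, mul_left_comm, ← Real.exp_add]
  gcongr
  rw [← add_div]
  gcongr
  linarith [norm_add_le z w]

/-! ### Growth of the reproducing kernel -/

variable [Fact (0 < σ)]

theorem norm_sq_mk {f : CSpace D → ℂ} (h1 : Differentiable ℂ f)
    (h2 : MemLp f 2 (laplaceMeasure D σ)) :
    ‖mk f h1 h2‖ ^ 2 = ∫ z, ‖f z‖ ^ 2 ∂(laplaceMeasure D σ) :=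
  norm_sq_eq _

/-- Translating `f` by `z` costs at most a factor `exp (‖z‖ / (2σ))` in norm, so that the bound on
evaluation at `0` spreads to all points. -/
theorem exists_norm_apply_le (D : ℕ) (σ : ℝ) [Fact (0 < σ)] :
    ∃ C : ℝ, 0 ≤ C ∧ ∀ (f : LaplaceSpace D σ) (z : CSpace D),
      ‖f z‖ ≤ C * Real.exp (‖z‖ / (2 * σ)) * ‖f‖ := by
  have hσ : 0 < σ := Fact.out
  obtain ⟨C, hC0, hC⟩ := exists_eval_bound (D := D) (σ := σ) 0
  refine ⟨C, hC0, fun f z => ?_⟩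
  have hf := f.differentiable_toFun
  have hint := ((integrable_laplaceMeasure_iff hσ).1 (integrable_sq f)).comp_add_left z
  have hle : ∀ w, laplaceDensity D σ w * ‖f.toFun (z + w)‖ ^ 2
      ≤ Real.exp (‖z‖ / σ) * (laplaceDensity D σ (z + w) * ‖f.toFun (z + w)‖ ^ 2) := fun w => by
    rw [← mul_assoc]
    gcongr
    exact laplaceDensity_le_add hσ z w
  have hd : Differentiable ℂ fun w => f.toFun (z + w) :=
    hf.comp ((differentiable_const z).add differentiable_id)
  have hint' : Integrable fun w => laplaceDensity D σ w * ‖f.toFun (z + w)‖ ^ 2 := by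
    refine (hint.const_mul (Real.exp (‖z‖ / σ))).mono'
      (continuous_laplaceDensity.mul (hd.continuous.norm.pow 2)).aestronglyMeasurable
      (Eventually.of_forall fun w => ?_)
    rw [Real.norm_of_nonneg (mul_nonneg (laplaceDensity_pos hσ w).le (by positivity))]
    exact hle w
  have hmem : MemLp (fun w => f.toFun (z + w)) 2 (laplaceMeasure D σ) :=
    (memLp_two_iff_integrable_sq_norm hd.continuous.aestronglyMeasurable).2
      ((integrable_laplaceMeasure_iff hσ).2 hint')
  have hnorm : ‖mk _ hd hmem‖ ≤ Real.exp (‖z‖ / (2 * σ)) * ‖f‖ := by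
    refine le_of_sq_le_sq ?_ (by positivity)
    rw [norm_sq_mk, mul_pow, norm_sq_eq, ← Real.exp_nat_mul, integral_laplaceMeasure hσ,
      integral_laplaceMeasure hσ,
      ← integral_add_left_eq_self (fun w => laplaceDensity D σ w * ‖f.toFun w‖ ^ 2) z,
      ← integral_const_mul]
    have h2 : ((2 : ℕ) : ℝ) * (‖z‖ / (2 * σ)) = ‖z‖ / σ := by
      push_cast
      field_simp
    rw [h2]
    exact integral_mono hint' (hint.const_mul _) hle
  have h0 : ‖f.toFun (z + 0)‖ ≤ C * ‖mk _ hd hmem‖ := hC (mk _ hd hmem) 0 (by simp)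
  rw [add_zero] at h0
  calc ‖f z‖ ≤ C * (Real.exp (‖z‖ / (2 * σ)) * ‖f‖) := h0.trans (by gcongr)
    _ = _ := by ring

theorem norm_apply_le_norm_kernelAt (f : LaplaceSpace D σ) (z : CSpace D) :
    ‖f z‖ ≤ ‖kernelAt D σ z‖ * ‖f‖ := by
  rw [← inner_kernelAt]
  exact norm_inner_le_norm _ _

/-- A bound for point evaluation at `z` bounds the reproducing kernel: apply it to `K_z` itself. -/
theorem norm_kernelAt_le {z : CSpace D} {M : ℝ} (hM : 0 ≤ M)
    (h : ∀ f : LaplaceSpace D σ, ‖f z‖ ≤ M * ‖f‖) : ‖kernelAt D σ z‖ ≤ M := by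
  have h1 := h (kernelAt D σ z)
  rw [← inner_kernelAt, inner_self_eq_norm_sq_to_K, norm_pow] at h1
  simp only [RCLike.norm_ofReal, abs_norm] at h1
  by_contra! hlt
  nlinarith [norm_nonneg (kernelAt D σ z)]

/-- The test functions `w ↦ exp (c ⟨u, w⟩)` with `u` in direction `z` have uniformly bounded norm
and modulus `exp (c ‖z‖)` at `z`. -/
theorem exists_le_norm_kernelAt (D : ℕ) (σ : ℝ) [Fact (0 < σ)] {c : ℝ} (hc0 : 0 ≤ c)
    (hc : c < 1 / (2 * σ)) :
    ∃ m : ℝ, 0 < m ∧ ∀ z : CSpace D, m * Real.exp (c * ‖z‖) ≤ ‖kernelAt D σ z‖ := by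
  have hσ : 0 < σ := Fact.out
  have hint : Integrable (fun z : CSpace D => Real.exp (2 * c * ‖z‖)) (laplaceMeasure D σ) := by
    refine integrable_exp_mul_norm hσ ?_
    rw [lt_div_iff₀ (by positivity)] at hc ⊢
    linarith
  set I := ∫ z : CSpace D, Real.exp (2 * c * ‖z‖) ∂(laplaceMeasure D σ) with hI
  have hI0 : 0 ≤ I := integral_nonneg fun z => (Real.exp_pos _).le
  refine ⟨(Real.sqrt I + 1)⁻¹, by positivity, fun z => ?_⟩
  set u : CSpace D := ((‖z‖⁻¹ : ℝ) : ℂ) • z with hu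
  have hu1 : ‖u‖ ≤ 1 := by
    rw [hu, norm_smul, Complex.norm_real, norm_inv, norm_norm]
    exact inv_mul_le_one
  have huz : (inner ℂ u z).re = ‖z‖ := by
    rw [hu, inner_smul_left, inner_self_eq_norm_sq_to_K, Complex.conj_ofReal]
    rcases eq_or_ne ‖z‖ 0 with h | h
    · simp [h]
    · simp only [RCLike.ofReal_eq_complex_ofReal, ← Complex.ofReal_pow, ← Complex.ofReal_mul,
        Complex.ofReal_re]
      field_simp
  have hd : Differentiable ℂ fun w : CSpace D => Complex.exp (c * inner ℂ u w) :=
    (((innerSL ℂ u).differentiable).const_mul (c : ℂ)).cexp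
  have hnorm : ∀ w : CSpace D, ‖Complex.exp (c * inner ℂ u w)‖ = Real.exp (c * (inner ℂ u w).re) :=
    fun w => by rw [Complex.norm_exp, Complex.re_ofReal_mul]
  have hle : ∀ w : CSpace D, ‖Complex.exp (c * inner ℂ u w)‖ ^ 2 ≤ Real.exp (2 * c * ‖w‖) := by
    intro w
    rw [hnorm, ← Real.exp_nat_mul]
    have h1 : (inner ℂ u w).re ≤ ‖w‖ :=
      (Complex.re_le_norm _).trans ((norm_inner_le_norm u w).trans
        (mul_le_of_le_one_left (norm_nonneg _) hu1))
    refine Real.exp_le_exp.2 ?_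
    push_cast
    nlinarith [mul_le_mul_of_nonneg_left h1 hc0]
  have hint' : Integrable (fun w : CSpace D => ‖Complex.exp (c * inner ℂ u w)‖ ^ 2)
      (laplaceMeasure D σ) :=
    hint.mono' (hd.continuous.norm.pow 2).aestronglyMeasurable
      (Eventually.of_forall fun w => by
        rw [Real.norm_of_nonneg (by positivity)]
        exact hle w)
  have hmem := (memLp_two_iff_integrable_sq_norm hd.continuous.aestronglyMeasurable).2 hint'
  have hf : ‖mk _ hd hmem‖ ≤ Real.sqrt I + 1 := by
    have : ‖mk _ hd hmem‖ ≤ Real.sqrt I := by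
      refine Real.le_sqrt_of_sq_le ?_
      rw [norm_sq_mk]
      exact integral_mono hint' hint hle
    linarith
  have h := norm_apply_le_norm_kernelAt (mk _ hd hmem) z
  have hz : ‖mk (σ := σ) _ hd hmem z‖ = Real.exp (c * ‖z‖) := by
    change ‖Complex.exp (c * inner ℂ u z)‖ = _
    rw [hnorm, huz]
  rw [hz] at h
  rw [inv_mul_le_iff₀ (by positivity)]
  calc Real.exp (c * ‖z‖) ≤ ‖kernelAt D σ z‖ * ‖mk _ hd hmem‖ := h
    _ ≤ ‖kernelAt D σ z‖ * (Real.sqrt I + 1) := by gcongr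
    _ = _ := mul_comm _ _

theorem adjoint_kernelAt {φ : CSpace D → CSpace D} {T : LaplaceSpace D σ →L[ℂ] LaplaceSpace D σ}
    (hT : IsKoopman φ T) (z : CSpace D) :
    ContinuousLinearMap.adjoint T (kernelAt D σ z) = kernelAt D σ (φ z) := by
  refine ext_inner_right ℂ fun f => ?_
  rw [ContinuousLinearMap.adjoint_inner_left, inner_kernelAt, inner_kernelAt, hT]

/-! ### A compactness criterion -/

instance : SecondCountableTopology (LaplaceSpace D σ) := by
  have : Fact ((2 : ENNReal) ≠ ⊤) := ⟨by norm_num⟩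
  have : SFinite (laplaceMeasure D σ) := by unfold laplaceMeasure; infer_instance
  exact (toLpₗᵢ (D := D) (σ := σ)).isometry.isEmbedding.secondCountableTopology

/-- Bounded sequences have pointwise convergent subsequences, by the sequential Banach-Alaoglu
theorem. -/
theorem exists_subseq_tendsto_apply {F : ℕ → LaplaceSpace D σ} (hF : ∀ n, ‖F n‖ ≤ 1) :
    ∃ (f : LaplaceSpace D σ) (ns : ℕ → ℕ), ‖f‖ ≤ 1 ∧ StrictMono ns ∧
      ∀ z, Tendsto (fun n => F (ns n) z) atTop (𝓝 (f z)) := by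
  obtain ⟨x, hx, ns, hns, hlim⟩ := WeakDual.isSeqCompact_closedBall ℂ (LaplaceSpace D σ) 0 1
    (x := fun n => StrongDual.toWeakDual (InnerProductSpace.toDual ℂ _ (F n)))
    (fun n => by simpa using hF n)
  set f := (InnerProductSpace.toDual ℂ (LaplaceSpace D σ)).symm (WeakDual.toStrongDual x) with hf
  refine ⟨f, ns, by simpa [hf] using hx, hns, fun z => ?_⟩
  have h := ((WeakBilin.eval_continuous _ (kernelAt D σ z)).tendsto x).comp hlim
  have h1 : ∀ g : LaplaceSpace D σ, g z = conj (inner ℂ g (kernelAt D σ z)) := fun g => by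
    rw [inner_conj_symm, inner_kernelAt]
  simp only [h1]
  refine (Complex.continuous_conj.tendsto _).comp ?_
  have h2 : inner ℂ f (kernelAt D σ z) = x (kernelAt D σ z) := by
    rw [hf, InnerProductSpace.toDual_symm_apply]; rfl
  rw [h2]
  exact h

/-- Dominated convergence in `H_L`: pointwise convergence with an `L²` bound on the differences
gives convergence in norm. -/
theorem tendsto_of_dominated {F : ℕ → LaplaceSpace D σ} {f : LaplaceSpace D σ}
    {g : CSpace D → ℝ} (hg : Integrable (fun z => g z ^ 2) (laplaceMeasure D σ))
    (hF : ∀ n z, ‖F n z - f z‖ ≤ g z)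
    (hlim : ∀ z, Tendsto (fun n => F n z) atTop (𝓝 (f z))) : Tendsto F atTop (𝓝 f) := by
  rw [tendsto_iff_norm_sub_tendsto_zero]
  have h : Tendsto (fun n => ‖F n - f‖ ^ 2) atTop (𝓝 0) := by
    simp only [norm_sq_eq]
    rw [← integral_zero (CSpace D) ℝ (μ := laplaceMeasure D σ)]
    refine tendsto_integral_of_dominated_convergence _
      (fun n => (integrable_sq (F n - f)).aestronglyMeasurable) hg
      (fun n => Eventually.of_forall fun z => ?_) (Eventually.of_forall fun z => ?_)
    · rw [Real.norm_of_nonneg (by positivity)]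
      exact pow_le_pow_left₀ (norm_nonneg _) (hF n z) 2
    · have h0 := (tendsto_iff_norm_sub_tendsto_zero.1 (hlim z)).pow 2
      rwa [zero_pow two_ne_zero] at h0
  have hsqrt := (Real.continuous_sqrt.tendsto 0).comp h
  rw [Real.sqrt_zero] at hsqrt
  exact hsqrt.congr fun n => Real.sqrt_sq (norm_nonneg _)

/-- If some `g ∈ L²(μ_L)` dominates pointwise the image of the unit ball, then the Koopman operator
is compact: dominated convergence turns pointwise convergence of functions in the unit ball into
norm convergence of their images. -/
theorem IsKoopman.isCompactOperator {φ : CSpace D → CSpace D}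
    {T : LaplaceSpace D σ →L[ℂ] LaplaceSpace D σ} (hT : IsKoopman φ T) {g : CSpace D → ℝ}
    (hg : Integrable (fun z => g z ^ 2) (laplaceMeasure D σ))
    (hg0 : ∀ z, 0 ≤ g z) (hTg : ∀ (f : LaplaceSpace D σ) z, ‖T f z‖ ≤ g z * ‖f‖) : IsCompactOperator T := by
  refine (isCompactOperator_iff_image_closedBall_subset_compact 
    (T : LaplaceSpace D σ →ₗ[ℂ] LaplaceSpace D σ) one_pos).2
    ⟨T '' Metric.closedBall 0 1, IsSeqCompact.isCompact fun y hy => ?_, subset_rfl⟩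
  choose F hF hFy using hy
  obtain ⟨f, ns, hf, hns, hlim⟩ := exists_subseq_tendsto_apply
    (F := F) (fun n => by simpa using hF n)
  refine ⟨T f, ⟨f, by simpa using hf, rfl⟩, ns, hns, ?_⟩
  refine tendsto_of_dominated (g := fun z => 2 * g z) ?_ (fun n z => ?_) fun z => ?_
  · simpa only [mul_pow] using hg.const_mul (2 ^ 2)
  · have hz := hg0 z
    have h1 := hTg (F (ns n) - f) z
    have h2 : ‖F (ns n) - f‖ ≤ 2 := by
      have := norm_sub_le (F (ns n)) f
      have := hF (ns n)
      rw [mem_closedBall_zero_iff] at this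
      linarith
    have h3 : T (F (ns n) - f) z = T (F (ns n)) z - T f z := by
      rw [map_sub]
      rfl
    rw [Function.comp_apply, ← hFy, ← h3]
    nlinarith
  · simp only [Function.comp_apply, ← hFy, hT _ z]
    exact hlim (φ z)

/-! ### Affine symbols -/

/-- The images under the Koopman operator of an affine symbol grow at most like
`exp (a ‖z‖ / (2σ))`, where `a` is the Frobenius norm of the linear part. -/
theorem exists_norm_apply_affineSymbol_le (σ : ℝ) [Fact (0 < σ)] (A : Matrix (Fin D) (Fin D) ℂ)
    (b : CSpace D) :
    ∃ C : ℝ, 0 ≤ C ∧ ∀ (f : LaplaceSpace D σ) (z : CSpace D),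
      ‖f (affineSymbol A b z)‖ ≤ C * Real.exp (frobeniusNorm A / (2 * σ) * ‖z‖) * ‖f‖ := by
  have hσ : 0 < σ := Fact.out
  obtain ⟨C, hC0, hC⟩ := exists_norm_apply_le D σ
  refine ⟨C * Real.exp (‖b‖ / (2 * σ)), by positivity, fun f z => (hC f _).trans ?_⟩
  rw [mul_assoc C (Real.exp _) (Real.exp _), ← Real.exp_add]
  gcongr
  rw [div_mul_eq_mul_div, ← add_div]
  gcongr
  have h := norm_add_le (Matrix.toEuclideanLin A z) b
  have h' := norm_toEuclideanLin_le A z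
  rw [affineSymbol]
  linarith

theorem isCompactOperator_affineSymbol {A : Matrix (Fin D) (Fin D) ℂ} {b : CSpace D}
    (hA : frobeniusNorm A < 1) {T : LaplaceSpace D σ →L[ℂ] LaplaceSpace D σ}
    (hT : IsKoopman (affineSymbol A b) T) : IsCompactOperator T := by
  have hσ : 0 < σ := Fact.out
  obtain ⟨C, hC0, hC⟩ := exists_norm_apply_affineSymbol_le σ A b
  refine hT.isCompactOperator (g := fun z => C * Real.exp (frobeniusNorm A / (2 * σ) * ‖z‖)) ?_
    (fun z => by positivity) fun f z => by rw [hT]; exact hC f z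
  have hint := integrable_exp_mul_norm (D := D) hσ (c := frobeniusNorm A / σ) (by gcongr)
  refine (hint.const_mul (C ^ 2)).congr (Eventually.of_forall fun z => ?_)
  simp only [mul_pow, ← Real.exp_nat_mul]
  congr 2
  push_cast
  field_simp

theorem tendsto_berezin_affineSymbol {A : Matrix (Fin D) (Fin D) ℂ} {b : CSpace D}
    (hA : frobeniusNorm A < 1) {T : LaplaceSpace D σ →L[ℂ] LaplaceSpace D σ}
    (hT : IsKoopman (affineSymbol A b) T) :
    Tendsto (fun z => berezin T z) (comap (fun z : CSpace D => ‖z‖) atTop) (𝓝 0) := by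
  have hσ : 0 < σ := Fact.out
  set a := frobeniusNorm A with ha
  have ha0 : 0 ≤ a := Real.sqrt_nonneg _
  obtain ⟨C, hC0, hC⟩ := exists_norm_apply_affineSymbol_le σ A b
  -- the midpoint of `a / (2σ)` and `1 / (2σ)`
  obtain ⟨m, hm0, hm⟩ := exists_le_norm_kernelAt D σ (c := (1 + a) / 2 / (2 * σ)) (by positivity)
    (by gcongr; linarith)
  set δ : ℝ := (1 - a) / 2 / (2 * σ) with hδ
  have hδ0 : 0 < δ := by
    have : 0 < 1 - a := sub_pos.2 hA
    positivity
  have hle : ∀ z : CSpace D, berezin T z ≤ (C / m * Real.exp (-(δ * ‖z‖))) ^ 2 := fun z => by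
    rw [berezin, adjoint_kernelAt hT, ← inv_pow, ← mul_pow, inv_mul_eq_div]
    gcongr
    calc ‖kernelAt D σ (affineSymbol A b z)‖ / ‖kernelAt D σ z‖
        ≤ C * Real.exp (a / (2 * σ) * ‖z‖) / (m * Real.exp ((1 + a) / 2 / (2 * σ) * ‖z‖)) :=
          div_le_div₀ (by positivity) (norm_kernelAt_le (by positivity) fun f => hC f z)
            (by positivity) (hm z)
      _ = C / m * Real.exp (-(δ * ‖z‖)) := by
          rw [mul_div_mul_comm, ← Real.exp_sub, hδ]
          congr 2
          ring
  have hlim : Tendsto (fun r : ℝ => (C / m * Real.exp (-(δ * r))) ^ 2) atTop (𝓝 0) := by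
    have h := (Real.tendsto_exp_neg_atTop_nhds_zero.comp
      (tendsto_id.const_mul_atTop hδ0)).const_mul (C / m) |>.pow 2
    simpa using h
  refine squeeze_zero (fun z => ?_) hle (hlim.comp tendsto_comap)
  rw [berezin]
  positivity

end LaplaceSpace

theorem mainTheorem4 (D : ℕ) (σ : ℝ) [Fact (0 < σ)]
    (A : Matrix (Fin D) (Fin D) ℂ) (b : CSpace D)
    (hA : IsUnit A) (hA0 : 0 < frobeniusNorm A) (hA1 : frobeniusNorm A < 1)
    (T : LaplaceSpace D σ →L[ℂ] LaplaceSpace D σ)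
    (hT : LaplaceSpace.IsKoopman (affineSymbol A b) T) :
    IsCompactOperator T ↔
      Tendsto (fun z : CSpace D => LaplaceSpace.berezin T z)
        (comap (fun z : CSpace D => ‖z‖) atTop) (𝓝 0) := by
  exact iff_of_true (LaplaceSpace.isCompactOperator_affineSymbol hA1 hT)
    (LaplaceSpace.tendsto_berezin_affineSymbol hA1 hT)
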